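/- For a nonempty bounded subset $S$ of a Euclidean space and $\epsilon>0$ let $P(S,\epsilon)$ be the maximal number of pairwise disjoint balls of radius $\epsilon$ with centers in $S$, and let $$\underline{\dim}_M S=\liminf_{\epsilon\downarrow 0}\frac{\log P(S,\epsilon)}{\log \epsilon^{-1}},\qquad \overline{\dim}_M S=\limsup_{\epsilon\downarrow 0}\frac{\log P(S,\epsilon)}{\log \epsilon^{-1}}$$ be its lower and upper Minkowski dimensions. For $h:[0,1]\to\mathbb{R}^d$ and $A\subseteq[0,1]$ write $G_A(h)=\{(t,h(t)):t\in A\}\subseteq\mathbb{R}^{d+1}$. Theorem. Let $(B_t)_{t\ge 0}$ be a standard Brownian motion in $\mathbb{R}^d$, $d\ge 1$, let $f:[0,1]\to\mathbb{R}^d$ be a càdlàg function, and let $A$ be an arbitrary nonempty subset of $[0,1]$. Then there exist real constants $c_3$ and $c_4$ such that, almost surely, $$\underline{\dim}_M G_A(B+f)=c_3\quad\text{and}\quad \overline{\dim}_M G_A(B+f)=c_4.$$ -/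

import Mathlib

namespace BrownianDrift

open MeasureTheory ProbabilityTheory Filter Set
open scoped NNReal ENNReal Topology unitInterval

/-- A function on `[0,1]` is càdlàg if it is right-continuous and has left limits. (At the right
endpoint the first condition and at the left endpoint the second condition is void.) -/
def IsCadlag {E : Type*} [TopologicalSpace E] (f : I → E) : Prop :=
  (∀ t : I, ContinuousWithinAt f (Ioi t) t) ∧
    ∀ t : I, ∃ l : E, Tendsto f (𝓝[<] t) (𝓝 l)

/-- `B` is a standard Brownian motion in `ℝᵈ`: its coordinates are independent (as processes)
standard real Brownian motions, started at `0` and with almost surely continuous paths. -/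
structure IsStandardBrownian {Ω : Type*} [MeasurableSpace Ω] {d : ℕ}
    (B : ℝ≥0 → Ω → EuclideanSpace ℝ (Fin d)) (P : Measure Ω) : Prop where
  coord : ∀ i : Fin d, IsBrownianReal (fun t ω => B t ω i) P
  indep : iIndepFun (fun (i : Fin d) (ω : Ω) (t : ℝ≥0) => B t ω i) P

/-- The maximal number of pairwise disjoint open balls of radius `ε` with centers in `A`
(the value is `⊤` if there is no bound on this number). -/
noncomputable def ballPacking {E : Type*} [PseudoMetricSpace E] (A : Set E) (ε : ℝ) : ℕ∞ :=
  ⨆ k ∈ {k : ℕ | ∃ x : Fin k → E, (∀ i, x i ∈ A) ∧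
    ∀ i j, i ≠ j → Disjoint (Metric.ball (x i) ε) (Metric.ball (x j) ε)}, (k : ℕ∞)

/-- The quotient `log P(A, ε) / log ε⁻¹`, as an extended real number. -/
noncomputable def packingRatio {E : Type*} [PseudoMetricSpace E] (A : Set E) (ε : ℝ) : EReal :=
  ENNReal.log (ballPacking A ε : ℝ≥0∞) / (Real.log ε⁻¹ : EReal)

/-- The lower Minkowski dimension (meaningful for nonempty bounded sets). -/
noncomputable def lowerMinkowskiDim {E : Type*} [PseudoMetricSpace E] (A : Set E) : EReal :=
  liminf (packingRatio A) (𝓝[>] (0 : ℝ))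

/-- The upper Minkowski dimension (meaningful for nonempty bounded sets). -/
noncomputable def upperMinkowskiDim {E : Type*} [PseudoMetricSpace E] (A : Set E) : EReal :=
  limsup (packingRatio A) (𝓝[>] (0 : ℝ))

/-- The graph `{(t, h t) : t ∈ A}` of `h` over `A`, in `ℝ × ℝᵈ` with its Euclidean metric. -/
def graphOver {d : ℕ} (h : I → EuclideanSpace ℝ (Fin d)) (A : Set I) :
    Set (WithLp 2 (ℝ × EuclideanSpace ℝ (Fin d))) :=
  (fun t : I => WithLp.toLp 2 ((t : ℝ), h t)) '' A

/-- The path `t ↦ B t + f t` on `[0,1]`. -/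
def driftedPath {Ω : Type*} {d : ℕ} (B : ℝ≥0 → Ω → EuclideanSpace ℝ (Fin d))
    (f : I → EuclideanSpace ℝ (Fin d)) (ω : Ω) : I → EuclideanSpace ℝ (Fin d) :=
  fun t => B (unitInterval.toNNReal t) ω + f t

end BrownianDrift

namespace BrownianDrift

open MeasureTheory ProbabilityTheory Filter Set
open scoped NNReal ENNReal Topology unitInterval

/-! ### Comparing limits at zero up to factors tending to one -/

section Asymptotics

/-! Minkowski dimensions are bi-Lipschitz invariants, and the shear (s, x) ↦ (s, x + g s) is
bi-Lipschitz on a graph when g is Lipschitz (`minkowskiDim_graph_add_eq`). The regression of B on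
its values at finitely many times is a random combination of Lipschitz functions of time: its
coefficients solve a linear system with a fixed matrix and right-hand side t ↦ min t s
(`exists_lipschitz_sum_mul_min_eq`). Subtracting it does not change the dimensions, and leaves a
Gaussian process uncorrelated with, hence independent of, those values (`exists_indepFun_sub_sum`).
So each dimension is independent of every finite family of values of B, hence of the σ-algebra they
all generate, hence of itself, and is almost surely constant
(`exists_ae_eq_const_of_forall_finset`).

Measurability comes from passing to a countable D ⊆ A over which the graph is dense for every
continuous path (`exists_countable_graphOver_subset_closure`), and to the radii 2⁻ⁿ. The constants
are finite because the graph is bounded (`upperMinkowskiDim_lt_top`). -/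

lemma le_of_forall_pos_le_one_add_mul {a b : EReal}
    (h : ∀ δ : ℝ, 0 < δ → a ≤ ((1 + δ : ℝ) : EReal) * b) : a ≤ b := by
  have h1 : Tendsto (fun δ : ℝ => ((1 + δ : ℝ) : EReal) * b) (𝓝[>] 0) (𝓝 (1 * b)) := by
    have h2 : Tendsto (fun δ : ℝ => (((1 + δ : ℝ) : EReal), b)) (𝓝[>] 0) (𝓝 ((1 : EReal), b)) := by
      refine Tendsto.prodMk_nhds ?_ tendsto_const_nhds
      have : Tendsto (fun δ : ℝ => ((1 + δ : ℝ) : EReal)) (𝓝 0) (𝓝 (((1 + 0 : ℝ)) : EReal)) :=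
        (continuous_coe_real_ereal.comp (continuous_const.add continuous_id)).tendsto 0
      simp only [add_zero, EReal.coe_one] at this
      exact this.mono_left nhdsWithin_le_nhds
    have h3 : (1 : EReal) ≠ ⊥ := EReal.coe_ne_bot 1
    have h4 : (1 : EReal) ≠ ⊤ := EReal.coe_ne_top 1
    -- Multiplication is continuous at (1, b) even for infinite b, since 1 is finite and nonzero.
    exact Tendsto.comp (EReal.continuousAt_mul (p := ((1 : EReal), b)) (Or.inl one_ne_zero)
      (Or.inl one_ne_zero) (Or.inl h3) (Or.inl h4)) h2
  rw [one_mul] at h1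
  exact ge_of_tendsto h1 (eventually_mem_nhdsWithin.mono fun δ hδ => h δ hδ)

/-- Here φ is a change of scale; the factor 1 + δ absorbs the resulting change of the denominator
log ε⁻¹. Composing with φ can only raise a liminf and lower a limsup, which dictates on which side φ
appears here and in the limsup version. -/
lemma liminf_le_liminf_of_eventually_le_mul {α β : Type*} {l₁ : Filter α} {l₂ : Filter β}
    [NeBot l₁] {u : α → EReal} {v : β → EReal} {φ : α → β} (hφ : Tendsto φ l₁ l₂)
    (h : ∀ δ : ℝ, 0 < δ → ∀ᶠ a in l₁, v (φ a) ≤ ((1 + δ : ℝ) : EReal) * u a) :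
    liminf v l₂ ≤ liminf u l₁ := by
  refine le_of_forall_pos_le_one_add_mul fun δ hδ => ?_
  rw [← EReal.liminf_const_mul_of_nonneg_of_ne_top (EReal.coe_nonneg.2 (by positivity))
    (EReal.coe_ne_top _)]
  exact (liminf_le_liminf_of_le hφ).trans
    ((liminf_comp v φ l₁).symm.le.trans (liminf_le_liminf (h δ hδ)))

lemma limsup_le_limsup_of_eventually_le_mul {α β : Type*} {l₁ : Filter α} {l₂ : Filter β}
    [NeBot l₁] {u : α → EReal} {v : β → EReal} {φ : α → β} (hφ : Tendsto φ l₁ l₂)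
    (h : ∀ δ : ℝ, 0 < δ → ∀ᶠ a in l₁, u a ≤ ((1 + δ : ℝ) : EReal) * v (φ a)) :
    limsup u l₁ ≤ limsup v l₂ := by
  refine le_of_forall_pos_le_one_add_mul fun δ hδ => ?_
  refine (limsup_le_limsup (h δ hδ)).trans ?_
  rw [EReal.limsup_const_mul_of_nonneg_of_ne_top (EReal.coe_nonneg.2 (by positivity))
    (EReal.coe_ne_top _)]
  gcongr
  exact (limsup_comp v φ l₁).le.trans (limsup_le_limsup_of_le hφ)

lemma ereal_div_le_mul_div {u v : EReal} {x y c : ℝ} (hv : 0 ≤ v) (huv : u ≤ v)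
    (hx : 0 < x) (hy : 0 < y) (hxy : y ≤ c * x) : u / x ≤ (c : EReal) * (v / y) := by
  rw [EReal.div_le_iff_le_mul (EReal.coe_pos.2 hx) (EReal.coe_ne_top _), ← mul_assoc,
    ← EReal.coe_mul]
  have h1 : v = (y : EReal) * (v / y) :=
    (EReal.mul_div_cancel (EReal.coe_ne_bot _) (EReal.coe_ne_top _) (EReal.coe_pos.2 hy).ne').symm
  refine huv.trans (h1.le.trans ?_)
  refine mul_le_mul_of_nonneg_right (EReal.coe_le_coe_iff.2 (by linarith)) ?_
  exact EReal.div_nonneg hv (EReal.coe_nonneg.2 hy.le)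

lemma eventually_lt_mul_log_inv (C : ℝ) {δ : ℝ} (hδ : 0 < δ) :
    ∀ᶠ ε in 𝓝[>] (0 : ℝ), C < δ * Real.log ε⁻¹ :=
  ((Real.tendsto_log_atTop.comp tendsto_inv_nhdsGT_zero).const_mul_atTop hδ).eventually_gt_atTop C

lemma tendsto_mul_const_nhdsGT_zero {c : ℝ} (hc : 0 < c) :
    Tendsto (fun ε : ℝ => c * ε) (𝓝[>] 0) (𝓝[>] 0) := by
  refine tendsto_nhdsWithin_iff.2 ⟨?_, eventually_mem_nhdsWithin.mono fun ε hε => mul_pos hc hε⟩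
  have : Tendsto (fun ε : ℝ => c * ε) (𝓝 0) (𝓝 (c * 0)) :=
    (continuous_const.mul continuous_id).tendsto 0
  rw [mul_zero] at this
  exact this.mono_left nhdsWithin_le_nhds

end Asymptotics

/-! ### Packing numbers, rescaling, and dyadic radii -/

section Packing

variable {E F : Type*} [PseudoMetricSpace E] [PseudoMetricSpace F]

lemma le_ballPacking {S : Set E} {ε : ℝ} {k : ℕ} (x : Fin k → E) (hx : ∀ i, x i ∈ S)
    (hd : ∀ i j, i ≠ j → Disjoint (Metric.ball (x i) ε) (Metric.ball (x j) ε)) :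
    (k : ℕ∞) ≤ ballPacking S ε :=
  le_iSup₂ (f := fun (k : ℕ) (_ : k ∈ {k : ℕ | ∃ x : Fin k → E, (∀ i, x i ∈ S) ∧
    ∀ i j, i ≠ j → Disjoint (Metric.ball (x i) ε) (Metric.ball (x j) ε)}) => (k : ℕ∞))
    k ⟨x, hx, hd⟩

lemma ballPacking_le {S : Set E} {ε : ℝ} {N : ℕ∞} (h : ∀ (k : ℕ) (x : Fin k → E), (∀ i, x i ∈ S) →
    (∀ i j, i ≠ j → Disjoint (Metric.ball (x i) ε) (Metric.ball (x j) ε)) → (k : ℕ∞) ≤ N) :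
    ballPacking S ε ≤ N :=
  iSup₂_le fun k ⟨x, hx, hd⟩ => h k x hx hd

lemma one_le_ballPacking {S : Set E} (hS : S.Nonempty) (ε : ℝ) : 1 ≤ ballPacking S ε := by
  obtain ⟨s, hs⟩ := hS
  simpa using le_ballPacking (k := 1) (ε := ε) (fun _ => s) (fun _ => hs)
    fun i j hij => (hij (Subsingleton.elim i j)).elim

lemma ballPacking_anti (S : Set E) {ε ε' : ℝ} (h : ε ≤ ε') :
    ballPacking S ε' ≤ ballPacking S ε :=
  ballPacking_le fun _ x hx hd => le_ballPacking x hx fun i j hij =>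
    (hd i j hij).mono (Metric.ball_subset_ball h) (Metric.ball_subset_ball h)

lemma ballPacking_mono {S T : Set E} (h : S ⊆ T) (ε : ℝ) :
    ballPacking S ε ≤ ballPacking T ε :=
  ballPacking_le fun _ x hx hd => le_ballPacking x (fun i => h (hx i)) hd

lemma log_ballPacking_nonneg {S : Set E} (hS : S.Nonempty) (ε : ℝ) :
    0 ≤ ENNReal.log (ballPacking S ε : ℝ≥0∞) := by
  rw [ENNReal.zero_le_log_iff]
  exact_mod_cast one_le_ballPacking hS ε

lemma log_ballPacking_le {S : Set E} {T : Set F} {ε ε' : ℝ}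
    (h : ballPacking S ε ≤ ballPacking T ε') :
    ENNReal.log (ballPacking S ε : ℝ≥0∞) ≤ ENNReal.log (ballPacking T ε' : ℝ≥0∞) :=
  ENNReal.log_monotone (by exact_mod_cast h)

lemma packingRatio_le_mul {S : Set E} {T : Set F} (hT : T.Nonempty) {ε ε' c : ℝ}
    (h : ballPacking S ε ≤ ballPacking T ε') (hε : 0 < Real.log ε⁻¹) (hε' : 0 < Real.log ε'⁻¹)
    (hc : Real.log ε'⁻¹ ≤ c * Real.log ε⁻¹) :
    packingRatio S ε ≤ (c : EReal) * packingRatio T ε' :=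
  ereal_div_le_mul_div (log_ballPacking_nonneg hT ε') (log_ballPacking_le h) hε hε' hc

lemma lowerMinkowskiDim_le_of_ballPacking_le {S : Set E} {T : Set F} (hT : T.Nonempty) {c : ℝ}
    (hc : 0 < c) (h : ∀ ε, 0 < ε → ballPacking S ε ≤ ballPacking T (c * ε)) :
    lowerMinkowskiDim S ≤ lowerMinkowskiDim T := by
  refine liminf_le_liminf_of_eventually_le_mul (tendsto_mul_const_nhdsGT_zero (inv_pos.2 hc))
    fun δ hδ => ?_
  filter_upwards [eventually_mem_nhdsWithin, eventually_lt_mul_log_inv 0 one_pos,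
    eventually_lt_mul_log_inv (-Real.log c) one_pos,
    eventually_lt_mul_log_inv (-(1 + δ) * Real.log c) hδ] with ε hε h1 h2 h3
  have hε : 0 < ε := hε
  have e : Real.log (c⁻¹ * ε)⁻¹ = Real.log c + Real.log ε⁻¹ := by
    rw [mul_inv, inv_inv, Real.log_mul hc.ne' (inv_pos.2 hε).ne']
  refine packingRatio_le_mul hT ?_ (by rw [e]; linarith) (by linarith) (by rw [e]; linarith)
  simpa [hc.ne'] using h (c⁻¹ * ε) (by positivity)

lemma upperMinkowskiDim_le_of_ballPacking_le {S : Set E} {T : Set F} (hT : T.Nonempty) {c : ℝ}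
    (hc : 0 < c) (h : ∀ ε, 0 < ε → ballPacking S ε ≤ ballPacking T (c * ε)) :
    upperMinkowskiDim S ≤ upperMinkowskiDim T := by
  refine limsup_le_limsup_of_eventually_le_mul (tendsto_mul_const_nhdsGT_zero hc)
    fun δ hδ => ?_
  filter_upwards [eventually_mem_nhdsWithin, eventually_lt_mul_log_inv 0 one_pos,
    eventually_lt_mul_log_inv (Real.log c) one_pos,
    eventually_lt_mul_log_inv (-Real.log c) hδ] with ε hε h1 h2 h3
  have hε : 0 < ε := hε
  have e : Real.log (c * ε)⁻¹ = -Real.log c + Real.log ε⁻¹ := by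
    rw [mul_inv, Real.log_mul (inv_pos.2 hc).ne' (inv_pos.2 hε).ne', Real.log_inv c]
  exact packingRatio_le_mul hT (h ε hε) (by linarith) (by rw [e]; linarith) (by rw [e]; linarith)

lemma log_inv_two_inv_pow (n : ℕ) : Real.log (((2 : ℝ)⁻¹) ^ n)⁻¹ = n * Real.log 2 := by
  rw [inv_pow, inv_inv, Real.log_pow]

lemma tendsto_two_inv_pow : Tendsto (fun n : ℕ => ((2 : ℝ)⁻¹) ^ n) atTop (𝓝[>] 0) :=
  tendsto_pow_atTop_nhdsWithin_zero_of_lt_one (by norm_num) (by norm_num)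

lemma tendsto_floor_log_inv :
    Tendsto (fun ε : ℝ => ⌊Real.log ε⁻¹ / Real.log 2⌋₊) (𝓝[>] 0) atTop :=
  tendsto_nat_floor_atTop.comp ((Real.tendsto_log_atTop.comp
    tendsto_inv_nhdsGT_zero).atTop_div_const (Real.log_pos one_lt_two))

/-- Packing numbers are monotone in the radius, and consecutive dyadic radii have logarithms
differing by a constant. The sequential form makes the dimension a countable liminf, hence
measurable. -/
lemma lowerMinkowskiDim_eq_liminf_two_inv_pow {S : Set E} (hS : S.Nonempty) :
    lowerMinkowskiDim S = liminf (fun n : ℕ => packingRatio S (2⁻¹ ^ n)) atTop := by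
  have l2 := Real.log_pos one_lt_two
  refine le_antisymm ((liminf_le_liminf_of_le tendsto_two_inv_pow).trans
    (liminf_comp (packingRatio S) _ atTop).symm.le) ?_
  refine liminf_le_liminf_of_eventually_le_mul tendsto_floor_log_inv fun δ hδ => ?_
  filter_upwards [eventually_mem_nhdsWithin, eventually_lt_mul_log_inv 0 one_pos,
    eventually_lt_mul_log_inv (Real.log 2) one_pos,
    eventually_lt_mul_log_inv ((1 + δ) * Real.log 2) hδ] with ε hε h1 h2 h3
  have hε : 0 < ε := hε
  set n := ⌊Real.log ε⁻¹ / Real.log 2⌋₊ with hn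
  have a1 : n * Real.log 2 ≤ Real.log ε⁻¹ :=
    (le_div_iff₀ l2).1 (Nat.floor_le (by rw [one_mul] at h1; positivity))
  have a2 : Real.log ε⁻¹ < (n + 1) * Real.log 2 := (div_lt_iff₀ l2).1 (Nat.lt_floor_add_one _)
  have e := log_inv_two_inv_pow n
  have a3 : ε ≤ 2⁻¹ ^ n := by
    rw [← inv_le_inv₀ (by positivity) hε, ← Real.log_le_log_iff (by positivity) (by positivity), e]
    exact a1
  exact packingRatio_le_mul hS (ballPacking_anti S a3) (by rw [e]; linarith) (by linarith)
    (by rw [e]; nlinarith)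

lemma upperMinkowskiDim_eq_limsup_two_inv_pow {S : Set E} (hS : S.Nonempty) :
    upperMinkowskiDim S = limsup (fun n : ℕ => packingRatio S (2⁻¹ ^ n)) atTop := by
  have l2 := Real.log_pos one_lt_two
  refine le_antisymm ?_ ((limsup_comp (packingRatio S) _ atTop).le.trans
    (limsup_le_limsup_of_le tendsto_two_inv_pow))
  -- An upper bound needs a dyadic radius below ε, hence the exponent n + 1; the liminf needs one
  -- above ε and uses n.
  refine limsup_le_limsup_of_eventually_le_mul
    ((tendsto_add_atTop_nat 1).comp tendsto_floor_log_inv) fun δ hδ => ?_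
  filter_upwards [eventually_mem_nhdsWithin, eventually_lt_mul_log_inv 0 one_pos,
    eventually_lt_mul_log_inv (Real.log 2) hδ] with ε hε h1 h2
  have hε : 0 < ε := hε
  simp only [Function.comp]
  set n := ⌊Real.log ε⁻¹ / Real.log 2⌋₊ with hn
  have a1 : n * Real.log 2 ≤ Real.log ε⁻¹ :=
    (le_div_iff₀ l2).1 (Nat.floor_le (by rw [one_mul] at h1; positivity))
  have a2 : Real.log ε⁻¹ < (n + 1) * Real.log 2 := (div_lt_iff₀ l2).1 (Nat.lt_floor_add_one _)
  have e := log_inv_two_inv_pow (n + 1)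
  push_cast at e
  have a3 : 2⁻¹ ^ (n + 1) ≤ ε := by
    rw [← inv_le_inv₀ hε (by positivity), ← Real.log_le_log_iff (by positivity) (by positivity), e]
    exact a2.le
  exact packingRatio_le_mul hS (ballPacking_anti S a3) (by linarith) (by rw [e]; linarith)
    (by rw [e]; linarith)

lemma lowerMinkowskiDim_nonneg {S : Set E} (hS : S.Nonempty) : 0 ≤ lowerMinkowskiDim S := by
  refine le_liminf_of_le (by isBoundedDefault) ?_
  filter_upwards [eventually_lt_mul_log_inv 0 one_pos] with ε h1
  exact EReal.div_nonneg (log_ballPacking_nonneg hS ε) (EReal.coe_nonneg.2 (by linarith))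

lemma lowerMinkowskiDim_le_upperMinkowskiDim (S : Set E) :
    lowerMinkowskiDim S ≤ upperMinkowskiDim S := liminf_le_limsup

end Packing

/-! ### Packings in real normed spaces, where disjointness of balls is a distance condition -/

section RealSpace

variable {E F : Type*} [NormedAddCommGroup E] [NormedSpace ℝ E]
  [NormedAddCommGroup F] [NormedSpace ℝ F]

/-- Packings of the range of a family are carried along if distances shrink by a bounded factor. -/
lemma ballPacking_range_le {ι : Type*} {p : ι → E} {q : ι → F} {L : ℝ} (hL : 0 < L)
    (h : ∀ i j, dist (p i) (p j) ≤ L * dist (q i) (q j)) {ε : ℝ} (hε : 0 < ε) :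
    ballPacking (range p) ε ≤ ballPacking (range q) (L⁻¹ * ε) := by
  refine ballPacking_le fun k x hx hd => ?_
  choose y hy using hx
  refine le_ballPacking (fun i => q (y i)) (fun i => mem_range_self _) fun i j hij => ?_
  have h1 := (disjoint_ball_ball_iff hε hε).1 (hd i j hij)
  rw [← hy, ← hy] at h1
  rw [disjoint_ball_ball_iff (by positivity) (by positivity), ← mul_add, inv_mul_le_iff₀ hL]
  exact h1.trans (h _ _)

/-- Moving each center by less than ε/2 keeps centers that were 2ε apart at distance at least ε. -/
lemma ballPacking_le_of_subset_closure {S T : Set E} (h : S ⊆ closure T) {ε : ℝ} (hε : 0 < ε) :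
    ballPacking S ε ≤ ballPacking T (2⁻¹ * ε) := by
  refine ballPacking_le fun k x hx hd => ?_
  have h2 : (0 : ℝ) < ε / 2 := by positivity
  choose y hy hxy using fun i => Metric.mem_closure_iff.1 (h (hx i)) (ε / 2) h2
  refine le_ballPacking y hy fun i j hij => ?_
  rw [disjoint_ball_ball_iff (by positivity) (by positivity)]
  have h1 := (disjoint_ball_ball_iff hε hε).1 (hd i j hij)
  have h3 := dist_triangle4 (x i) (y i) (y j) (x j)
  have h4 := hxy i
  have h5 := hxy j
  rw [dist_comm] at h5
  linarith

lemma minkowskiDim_eq_of_dense {S T : Set E} (hT : T.Nonempty) (hTS : T ⊆ S) (h : S ⊆ closure T) :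
    lowerMinkowskiDim S = lowerMinkowskiDim T ∧ upperMinkowskiDim S = upperMinkowskiDim T := by
  have h1 : ∀ ε, 0 < ε → ballPacking T ε ≤ ballPacking S (1 * ε) := fun ε _ => by
    rw [one_mul]; exact ballPacking_mono hTS ε
  have h2 : ∀ ε, 0 < ε → ballPacking S ε ≤ ballPacking T (2⁻¹ * ε) := fun ε hε =>
    ballPacking_le_of_subset_closure h hε
  exact ⟨(lowerMinkowskiDim_le_of_ballPacking_le hT (by norm_num) h2).antisymm
      (lowerMinkowskiDim_le_of_ballPacking_le (hT.mono hTS) one_pos h1),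
    (upperMinkowskiDim_le_of_ballPacking_le hT (by norm_num) h2).antisymm
      (upperMinkowskiDim_le_of_ballPacking_le (hT.mono hTS) one_pos h1)⟩

lemma minkowskiDim_range_le {ι : Type*} [Nonempty ι] {p : ι → E} {q : ι → F} {L : ℝ} (hL : 0 < L)
    (h : ∀ i j, dist (p i) (p j) ≤ L * dist (q i) (q j)) :
    lowerMinkowskiDim (range p) ≤ lowerMinkowskiDim (range q) ∧
      upperMinkowskiDim (range p) ≤ upperMinkowskiDim (range q) :=
  ⟨lowerMinkowskiDim_le_of_ballPacking_le (range_nonempty q) (inv_pos.2 hL)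
      fun _ hε => ballPacking_range_le hL h hε,
    upperMinkowskiDim_le_of_ballPacking_le (range_nonempty q) (inv_pos.2 hL)
      fun _ hε => ballPacking_range_le hL h hε⟩

/-- Volume comparison: the disjoint balls all lie in the ball of radius R + ε. -/
lemma ballPacking_le_of_subset_ball [FiniteDimensional ℝ E] {S : Set E} {R ε : ℝ} (hε : 0 < ε)
    (hR : 0 < R) (hS : S ⊆ Metric.ball 0 R) :
    ballPacking S ε ≤ (⌊((R + ε) / ε) ^ Module.finrank ℝ E⌋₊ : ℕ∞) := by
  borelize E
  set μ : Measure E := Measure.addHaar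
  set m := Module.finrank ℝ E with hm
  refine ballPacking_le fun k x hx hd => Nat.cast_le.2 (Nat.le_floor ?_)
  have h1 : μ (⋃ i, Metric.ball (x i) ε) = k * μ (Metric.ball 0 ε) := by
    rw [measure_iUnion (fun i j hij => hd i j hij) fun i => Metric.isOpen_ball.measurableSet]
    simp [Measure.addHaar_ball_center]
  have h2 : (⋃ i, Metric.ball (x i) ε) ⊆ Metric.ball 0 (R + ε) := by
    refine iUnion_subset fun i z hz => ?_
    have h3 := hS (hx i)
    rw [Metric.mem_ball] at h3 hz ⊢
    linarith [dist_triangle z (x i) 0]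
  have h3 := measure_mono (μ := μ) h2
  rw [h1, Measure.addHaar_ball_of_pos μ 0 hε,
    Measure.addHaar_ball_of_pos μ 0 (by positivity : 0 < R + ε), ← mul_assoc] at h3
  have h4 : μ (Metric.ball 0 1) ≠ 0 := (Metric.measure_ball_pos μ 0 one_pos).ne'
  have h5 : μ (Metric.ball 0 1) ≠ ⊤ := measure_ball_lt_top.ne
  rw [ENNReal.mul_le_mul_iff_left h4 h5, ← ENNReal.ofReal_natCast,
    ← ENNReal.ofReal_mul (by positivity), ENNReal.ofReal_le_ofReal_iff (by positivity)] at h3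
  rw [div_pow, le_div_iff₀ (by positivity)]
  exact h3

lemma upperMinkowskiDim_lt_top [FiniteDimensional ℝ E] {S : Set E}
    (hS : Bornology.IsBounded S) : upperMinkowskiDim S < ⊤ := by
  obtain ⟨R, hR, hSR⟩ := hS.subset_ball_lt 0 0
  set m := Module.finrank ℝ E with hm
  -- Only finiteness matters, so the crude exponent 2m is used: it absorbs R as soon as ε⁻¹ > R + 1.
  refine lt_of_le_of_lt (b := ((2 * m : ℝ) : EReal)) ?_ (EReal.coe_lt_top _)
  refine limsup_le_of_le (by isBoundedDefault) ?_
  filter_upwards [eventually_mem_nhdsWithin, eventually_lt_mul_log_inv 0 one_pos,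
    tendsto_inv_nhdsGT_zero.eventually_gt_atTop (R + 1)] with ε hε h1 h2
  have hε : 0 < ε := hε
  rw [one_mul] at h1
  have h3 : ((R + ε) / ε) ^ m ≤ ε⁻¹ ^ (2 * m) := by
    rw [pow_mul]
    refine pow_le_pow_left₀ (by positivity) ?_ m
    have h4 : ε ≤ 1 := by
      have : 1 < ε⁻¹ := by linarith
      exact ((one_lt_inv₀ hε).1 this).le
    rw [div_eq_mul_inv, sq]
    exact mul_le_mul_of_nonneg_right (by linarith) (by positivity)
  rw [packingRatio, EReal.div_le_iff_le_mul (EReal.coe_pos.2 h1) (EReal.coe_ne_top _)]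
  have h5 : (ballPacking S ε : ℝ≥0∞) ≤ ENNReal.ofReal (ε⁻¹ ^ (2 * m)) := by
    have h6 : (ballPacking S ε : ℝ≥0∞) ≤ ((⌊((R + ε) / ε) ^ m⌋₊ : ℕ∞) : ℝ≥0∞) := by
      exact_mod_cast ballPacking_le_of_subset_ball hε hR hSR
    refine h6.trans ?_
    rw [ENat.toENNReal_coe, ← ENNReal.ofReal_natCast]
    exact ENNReal.ofReal_le_ofReal ((Nat.floor_le (by positivity)).trans h3)
  refine (ENNReal.log_monotone h5).trans ?_
  rw [ENNReal.log_ofReal_of_pos (by positivity), Real.log_pow, ← EReal.coe_mul]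
  refine EReal.coe_le_coe_iff.2 (le_of_eq ?_)
  push_cast
  ring

end RealSpace

/-! ### Measurability of the dimensions of a countable random set -/

section Measurability

variable {Ω ι E : Type*} [MeasurableSpace Ω] [NormedAddCommGroup E] [NormedSpace ℝ E]

-- Indexing packings by tuples of indices, not of points, makes the family independent of p; for
-- countable ι the supremum is countable and its terms depend only on distances.
open Classical in
lemma ballPacking_range_eq_iSup (p : ι → E) {ε : ℝ} (hε : 0 < ε) :
    (ballPacking (range p) ε : ℝ≥0∞) = ⨆ (k : ℕ) (x : Fin k → ι),
      if ∀ i j, i ≠ j → ε + ε ≤ dist (p (x i)) (p (x j)) then (k : ℝ≥0∞) else 0 := by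
  refine le_antisymm ?_ (iSup₂_le fun k x => ?_)
  · rw [ballPacking, ENat.toENNReal_iSup]
    refine iSup_le fun k => ?_
    rw [ENat.toENNReal_iSup]
    refine iSup_le fun ⟨x, hx, hd⟩ => ?_
    choose y hy using hx
    refine le_trans ?_ (le_iSup₂ k y)
    rw [if_pos]
    · simp
    · intro i j hij
      rw [hy, hy]
      exact (disjoint_ball_ball_iff hε hε).1 (hd i j hij)
  · split_ifs with h
    · exact_mod_cast le_ballPacking (fun i => p (x i)) (fun i => mem_range_self _) fun i j hij =>
        (disjoint_ball_ball_iff hε hε).2 (h i j hij)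
    · exact zero_le

variable [Countable ι] [SecondCountableTopology E] [MeasurableSpace E] [BorelSpace E]

lemma measurable_packingRatio_range {p : Ω → ι → E} (hp : ∀ i, Measurable fun ω => p ω i) {ε : ℝ}
    (hε : 0 < ε) : Measurable fun ω => packingRatio (range (p ω)) ε := by
  have h : Measurable fun ω => (ballPacking (range (p ω)) ε : ℝ≥0∞) := by
    classical
    simp_rw [ballPacking_range_eq_iSup _ hε]
    refine Measurable.iSup fun k => Measurable.iSup fun x => ?_
    refine Measurable.ite ?_ measurable_const measurable_const
    simp only [ofPred_forall]
    refine MeasurableSet.iInter fun i => MeasurableSet.iInter fun j => MeasurableSet.iInter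
      fun _ => ?_
    exact measurableSet_le measurable_const ((hp _).dist (hp _))
  simp only [packingRatio, EReal.div_eq_inv_mul]
  fun_prop

lemma measurable_lowerMinkowskiDim_range [Nonempty ι] {p : Ω → ι → E}
    (hp : ∀ i, Measurable fun ω => p ω i) :
    Measurable fun ω => lowerMinkowskiDim (range (p ω)) := by
  simp_rw [lowerMinkowskiDim_eq_liminf_two_inv_pow (range_nonempty _)]
  exact Measurable.liminf fun n => measurable_packingRatio_range hp (by positivity)

lemma measurable_upperMinkowskiDim_range [Nonempty ι] {p : Ω → ι → E}
    (hp : ∀ i, Measurable fun ω => p ω i) :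
    Measurable fun ω => upperMinkowskiDim (range (p ω)) := by
  simp_rw [upperMinkowskiDim_eq_limsup_two_inv_pow (range_nonempty _)]
  exact Measurable.limsup fun n => measurable_packingRatio_range hp (by positivity)

end Measurability

/-! ### A zero-one law -/

section ZeroOne

variable {Ω : Type*} {mΩ : MeasurableSpace Ω} {P : Measure Ω} [IsProbabilityMeasure P]

/-- An extended real random variable independent of itself is almost surely constant. -/
lemma exists_ae_eq_const_of_indepFun_self {Z : Ω → EReal} (hZ : Measurable Z)
    (h : IndepFun Z Z P) : ∃ c, ∀ᵐ ω ∂P, Z ω = c := by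
  have h01 : ∀ s, MeasurableSet s → (∀ᵐ ω ∂P, Z ω ∈ s) ∨ ∀ᵐ ω ∂P, Z ω ∉ s := by
    intro s hs
    rcases measure_eq_zero_or_one_of_indepSet_self (μ := P)
      ((indepFun_iff_indepSet_preimage hZ hZ).1 h s s hs hs) with h0 | h1
    · exact Or.inr (measure_eq_zero_iff_ae_notMem.1 h0)
    · exact Or.inl ((prob_compl_eq_zero_iff (hZ hs)).2 h1)
  exact exists_eventuallyEq_const_of_forall_separating MeasurableSet h01

/-- If `Φ (X ω)` can, for every finite set of indices, be computed from a process independent of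
the values of `X` on this set, then it is almost surely constant. -/
lemma exists_ae_eq_const_of_forall_finset {ι : Type*} {X : ι → Ω → ℝ} (hX : ∀ i, Measurable (X i))
    {Φ : (ι → ℝ) → EReal} (hΦ : Measurable Φ)
    (h : ∀ S : Finset ι, ∃ Y : ι → Ω → ℝ,
      IndepFun (fun ω i => Y i ω) (fun ω (s : S) => X s ω) P ∧
        ∀ ω, Φ (fun i => X i ω) = Φ fun i => Y i ω) :
    ∃ c, ∀ᵐ ω ∂P, Φ (fun i => X i ω) = c := by
  classical
  set Z : Ω → EReal := fun ω => Φ fun i => X i ω with hZ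
  have hXm : Measurable fun ω i => X i ω := measurable_pi_lambda _ hX
  have hZm : Measurable Z := hΦ.comp hXm
  refine exists_ae_eq_const_of_indepFun_self hZm ?_
  let m : Finset ι → MeasurableSpace Ω := fun S =>
    MeasurableSpace.comap (fun ω (s : S) => X s ω) inferInstance
  have hm_le : ∀ S, m S ≤ mΩ := fun S =>
    Measurable.comap_le (f := fun ω (s : S) => X s ω) (measurable_pi_lambda _ fun s => hX s)
  have hm_mono : Monotone m := by
    intro S T hST
    refine Measurable.comap_le ?_
    refine @measurable_pi_lambda _ _ _ (m T) _ _ fun s => ?_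
    exact (measurable_pi_apply (⟨s, hST s.2⟩ : T)).comp
      (comap_measurable fun ω (s : T) => X s ω)
  have hind : ∀ S, Indep (m S) (MeasurableSpace.comap Z inferInstance) P := by
    intro S
    obtain ⟨Y, hY, hYX⟩ := h S
    have : Z = Φ ∘ fun ω i => Y i ω := funext hYX
    rw [this]
    exact ((hY.comp hΦ measurable_id).symm : IndepFun _ _ P)
  -- Z is independent of the σ-algebra generated by all X i, and is itself measurable for it.
  have hsup := indep_iSup_of_monotone hind hm_le hZm.comap_le hm_mono
  refine indep_of_indep_of_le_left hsup ?_
  refine Measurable.comap_le (hΦ.comp ?_)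
  refine @measurable_pi_lambda _ _ _ (⨆ S, m S) _ _ fun i => ?_
  have h1 : Measurable[m {i}] (X i) :=
    (measurable_pi_apply (⟨i, by simp⟩ : ({i} : Finset ι))).comp
      (comap_measurable fun ω (s : ({i} : Finset ι)) => X s ω)
  exact h1.mono (le_iSup m {i}) le_rfl

end ZeroOne

/-! ### Regression coefficients for the covariance min s t -/

section Regression

/-- A linear system that is solvable for every parameter and whose right-hand side is Lipschitz in
the parameter has a solution that is Lipschitz in the parameter. -/
lemma exists_lipschitz_solution {T κ : Type*} [PseudoMetricSpace T] [Fintype κ]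
    (M : (κ → ℝ) →ₗ[ℝ] (κ → ℝ)) {v : T → κ → ℝ} {K : ℝ≥0} (hv : LipschitzWith K v)
    (h : ∀ t, v t ∈ LinearMap.range M) :
    ∃ (K' : ℝ≥0) (c : T → κ → ℝ), LipschitzWith K' c ∧ ∀ t, M (c t) = v t := by
  -- M may be singular (the time 0 gives a zero row), so a linear section over its range replaces
  -- the inverse.
  obtain ⟨τ, hτ⟩ := M.rangeRestrict.exists_rightInverse_of_surjective M.range_rangeRestrict
  obtain ⟨N, hN⟩ := τ.exists_extend
  refine ⟨_, fun t => N (v t), N.toContinuousLinearMap.lipschitz.comp hv, fun t => ?_⟩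
  have h1 : N (v t) = τ ⟨v t, h t⟩ := by rw [← hN]; rfl
  have h2 := congrArg Subtype.val (LinearMap.congr_fun hτ ⟨v t, h t⟩)
  simp only [h1]
  exact h2

/-- Normal equations: take the coefficients of the orthogonal projection of x onto the span of the b
s. -/
lemma exists_sum_mul_inner_eq {E T : Type*} [NormedAddCommGroup E] [InnerProductSpace ℝ E]
    (b : T → E) (S : Finset T) (x : E) :
    ∃ a : S → ℝ, ∀ s : S, ∑ k, a k * inner ℝ (b k) (b s) = inner ℝ x (b s) := by
  let V : Submodule ℝ E := Submodule.span ℝ (range fun s : S => b s)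
  have : FiniteDimensional ℝ V := FiniteDimensional.span_of_finite ℝ (finite_range _)
  obtain ⟨a, ha⟩ := (Submodule.mem_span_range_iff_exists_fun ℝ).1 (V.starProjection_apply_mem x)
  refine ⟨a, fun s => ?_⟩
  have h1 : inner ℝ (x - V.starProjection x) (b s) = 0 :=
    V.starProjection_inner_eq_zero x _ (Submodule.subset_span (mem_range_self s))
  rw [inner_sub_left, ← ha, sum_inner, sub_eq_zero] at h1
  simp_rw [inner_smul_left] at h1
  simpa using h1.symm

/-- The coefficients of the regression of a Brownian motion on its values at finitely many times
are Lipschitz functions of the time. -/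
lemma exists_lipschitz_sum_mul_min_eq (S : Finset I) :
    ∃ (K : ℝ≥0) (c : I → S → ℝ), LipschitzWith K c ∧
      ∀ t, ∀ s : S, ∑ k, c t k * min (k : ℝ) (s : ℝ) = min (t : ℝ) (s : ℝ) := by
  -- The indicators of [0, t] in L² have Gram matrix min s t, so the system is one of normal
  -- equations and is solvable.
  let b : I → Lp ℝ 2 (volume : Measure ℝ) := fun t =>
    indicatorConstLp 2 (measurableSet_Icc (a := (0 : ℝ)) (b := t)) measure_Icc_lt_top.ne 1
  have hb : ∀ s t : I, inner ℝ (b s) (b t) = min (s : ℝ) (t : ℝ) := by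
    intro s t
    rw [L2.inner_indicatorConstLp_indicatorConstLp _ _ measure_Icc_lt_top.ne measure_Icc_lt_top.ne,
      Icc_inter_Icc, max_self, Real.volume_real_Icc_of_le (le_min s.2.1 t.2.1)]
    simp
  let M : (S → ℝ) →ₗ[ℝ] (S → ℝ) :=
    { toFun := fun a s => ∑ k, a k * min (k : ℝ) (s : ℝ)
      map_add' := fun x y => by ext s; simp [add_mul, Finset.sum_add_distrib]
      map_smul' := fun r x => by ext s; simp [mul_assoc, Finset.mul_sum] }
  have hv : LipschitzWith 1 fun (t : I) (s : S) => min (t : ℝ) s := by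
    refine LipschitzWith.of_dist_le_mul fun s t => ?_
    rw [NNReal.coe_one, one_mul]
    refine (dist_pi_le_iff dist_nonneg).2 fun r => ?_
    rw [Real.dist_eq, Subtype.dist_eq, Real.dist_eq]
    exact (abs_min_sub_min_le_max _ _ _ _).trans (by simp)
  have hr : ∀ t : I, (fun s : S => min (t : ℝ) s) ∈ LinearMap.range M := by
    intro t
    obtain ⟨a, ha⟩ := exists_sum_mul_inner_eq b S (b t)
    simp_rw [hb] at ha
    exact ⟨a, funext ha⟩
  obtain ⟨K, c, hc, hM⟩ := exists_lipschitz_solution M hv hr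
  exact ⟨K, c, hc, fun t s => congrFun (hM t) s⟩

end Regression

/-! ### Gaussian structure and independence of the residual -/

section GaussianProcess

variable {Ω : Type*} {mΩ : MeasurableSpace Ω} {P : Measure Ω} {d : ℕ}
  {B : ℝ≥0 → Ω → EuclideanSpace ℝ (Fin d)}

/-- All coordinates of a standard Brownian motion at all times are jointly Gaussian. -/
lemma IsStandardBrownian.isGaussianProcess (hB : IsStandardBrownian B P) :
    IsGaussianProcess (fun (p : Fin d × ℝ≥0) ω => B p.2 ω p.1) P where
  hasGaussianLaw J := by
    classical
    -- J need not be a product: the vector of all coordinates at all times in T is Gaussian, and the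
    -- one over J is a linear image of it.
    let T : Finset ℝ≥0 := J.image Prod.snd
    have h1 : ∀ i : Fin d, HasGaussianLaw (fun ω (t : T) => B t ω i) P := fun i =>
      (IsPreBrownianReal.isGaussianProcess (hB.coord i).toIsPreBrownianReal).hasGaussianLaw T
    have h2 : iIndepFun (fun (i : Fin d) ω (t : T) => B t ω i) P :=
      hB.indep.comp (fun _ w (t : T) => w t)
        fun _ => measurable_pi_lambda _ fun t => measurable_pi_apply _
    have h3 := h2.hasGaussianLaw h1
    let Λ : (Fin d → T → ℝ) →L[ℝ] (J → ℝ) := ContinuousLinearMap.pi fun p =>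
      (ContinuousLinearMap.proj (R := ℝ) (φ := fun _ : T => ℝ)
        ⟨p.1.2, Finset.mem_image_of_mem _ p.2⟩).comp
      (ContinuousLinearMap.proj (R := ℝ) (φ := fun _ : Fin d => T → ℝ) p.1.1)
    exact h3.map Λ

lemma IsStandardBrownian.covariance (hB : IsStandardBrownian B P) (p q : Fin d × ℝ≥0) :
    cov[fun ω => B p.2 ω p.1, fun ω => B q.2 ω q.1; P] =
      if p.1 = q.1 then min (p.2 : ℝ) q.2 else 0 := by
  obtain ⟨i, s⟩ := p
  obtain ⟨j, t⟩ := q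
  dsimp only
  split_ifs with h
  · subst h
    simpa using (hB.coord i).covariance_fun_eval s t
  · have h1 : IndepFun (fun ω => B s ω i) (fun ω => B t ω j) P :=
      (hB.indep.indepFun h).comp (φ := fun w : ℝ≥0 → ℝ => w s) (ψ := fun w : ℝ≥0 → ℝ => w t)
        (measurable_pi_apply s) (measurable_pi_apply t)
    exact h1.covariance_eq_zero
      (IsPreBrownianReal.isGaussianProcess
        (hB.coord i).toIsPreBrownianReal |>.hasGaussianLaw_eval s).memLp_two
      (IsPreBrownianReal.isGaussianProcess
        (hB.coord j).toIsPreBrownianReal |>.hasGaussianLaw_eval t).memLp_two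

/-- Subtracting from a process with the covariance of a Brownian motion on `[0,1]` a random
combination of finitely many Lipschitz functions makes it independent of its values at finitely
many places. -/
lemma exists_indepFun_sub_sum {X : Fin d × I → Ω → ℝ} (hX : IsGaussianProcess X P)
    (hcov : ∀ p q, cov[X p, X q; P] = if p.1 = q.1 then min (p.2 : ℝ) q.2 else 0)
    (S : Finset (Fin d × I)) :
    ∃ (T : Finset I) (K : ℝ≥0) (c : I → T → ℝ), LipschitzWith K c ∧
      IndepFun (fun ω p => X p ω - ∑ k : T, c p.2 k * X (p.1, k) ω) (fun ω (s : S) => X s ω) P := by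
  classical
  have : IsProbabilityMeasure P := hX.isProbabilityMeasure
  -- All times occurring in S serve every coordinate, so one coefficient function c works for all of
  -- them.
  let T : Finset I := S.image Prod.snd
  obtain ⟨K, c, hc, hmin⟩ := exists_lipschitz_sum_mul_min_eq T
  refine ⟨T, K, c, hc, ?_⟩
  have hL2 : ∀ p, MemLp (X p) 2 P := fun p => (hX.hasGaussianLaw_eval p).memLp_two
  have hsum : ∀ p : Fin d × I, MemLp (fun ω => ∑ k : T, c p.2 k * X (p.1, k) ω) 2 P := fun p =>
    memLp_finsetSum _ fun k _ => (hL2 _).const_mul _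
  refine IsGaussianProcess.indepFun_of_covariance_eq_zero
    (X := fun (p : Fin d × I) ω => X p ω - ∑ k : T, c p.2 k * X (p.1, k) ω)
    (Y := fun (s : S) ω => X s ω) ?_ ?_ ?_ ?_
  · refine hX.of_isGaussianProcess ?_
    rintro (p | s)
    · let J : Finset (Fin d × I) := insert p (T.image fun k => (p.1, k))
      refine ⟨J, ContinuousLinearMap.proj (R := ℝ) (φ := fun _ : J => ℝ)
          ⟨p, Finset.mem_insert_self _ _⟩ - ∑ k : T, c p.2 k •
          ContinuousLinearMap.proj (R := ℝ) (φ := fun _ : J => ℝ)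
          ⟨(p.1, k), Finset.mem_insert_of_mem (Finset.mem_image_of_mem _ k.2)⟩, fun ω => ?_⟩
      simp
    · exact ⟨{s.1}, ContinuousLinearMap.proj (R := ℝ) (φ := fun _ : ({s.1} : Finset _) => ℝ)
        ⟨s.1, Finset.mem_singleton_self _⟩, fun ω => rfl⟩
  · exact fun p => ((hL2 p).sub (hsum p)).aestronglyMeasurable.aemeasurable
  · exact fun s => hX.aemeasurable s
  · rintro p ⟨q, hq⟩
    have h1 := covariance_fun_sub_left (hL2 p) (hsum p) (hL2 q)
    refine h1.trans ?_
    rw [covariance_fun_sum_left (fun k => (hL2 _).const_mul _) (hL2 q)]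
    simp_rw [covariance_const_mul_left, hcov]
    -- Within one coordinate the normal equations cancel the covariance; across coordinates every
    -- term vanishes.
    by_cases h : p.1 = q.1
    · have := hmin p.2 ⟨q.2, Finset.mem_image_of_mem _ hq⟩
      simp only [h, if_true]
      rw [this, sub_self]
    · simp [h]

end GaussianProcess

/-! ### Shears of graphs, boundedness, and countable dense subgraphs -/

section Graph

variable {d : ℕ}

/-- The time coordinate is part of the distance, so it controls the increment of the added function.
The new distance is at most |s - t| + ‖x - y‖ + K|s - t|, whence 2 + K. -/
lemma dist_graph_add_le {s t : ℝ} {x y u v : EuclideanSpace ℝ (Fin d)} {K : ℝ}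
    (h : ‖u - v‖ ≤ K * |s - t|) (hK : 0 ≤ K) :
    dist (WithLp.toLp 2 (s, x + u)) (WithLp.toLp 2 (t, y + v)) ≤
      (2 + K) * dist (WithLp.toLp 2 (s, x)) (WithLp.toLp 2 (t, y)) := by
  have h1 : |s - t| ≤ dist (WithLp.toLp 2 (s, x)) (WithLp.toLp 2 (t, y)) := by
    rw [WithLp.prod_dist_eq_of_L2]
    refine Real.le_sqrt_of_sq_le ?_
    simp [Real.dist_eq]
  have h2 : ‖x - y‖ ≤ dist (WithLp.toLp 2 (s, x)) (WithLp.toLp 2 (t, y)) := by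
    rw [WithLp.prod_dist_eq_of_L2]
    refine Real.le_sqrt_of_sq_le ?_
    simp [dist_eq_norm, sq_nonneg]
  have h3 : dist (WithLp.toLp 2 (s, x + u)) (WithLp.toLp 2 (t, y + v)) ≤
      |s - t| + ‖(x + u) - (y + v)‖ := by
    rw [WithLp.prod_dist_eq_of_L2]
    refine Real.sqrt_le_iff.2 ⟨by positivity, ?_⟩
    simp only [dist_eq_norm, WithLp.toLp_fst, WithLp.toLp_snd, Real.norm_eq_abs]
    nlinarith [abs_nonneg (s - t), norm_nonneg (x + u - (y + v)),
      mul_nonneg (abs_nonneg (s - t)) (norm_nonneg (x + u - (y + v)))]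
  have h4 : ‖(x + u) - (y + v)‖ ≤ ‖x - y‖ + ‖u - v‖ := by
    rw [add_sub_add_comm]; exact norm_add_le _ _
  nlinarith [mul_le_mul_of_nonneg_left h1 hK]

/-- Adding a Lipschitz function does not change the Minkowski dimensions of a graph. -/
lemma minkowskiDim_graph_add_eq {D : Set I} [Nonempty D] (h g : D → EuclideanSpace ℝ (Fin d))
    {K : ℝ} (hK : 0 ≤ K) (hg : ∀ s t : D, ‖g s - g t‖ ≤ K * |(s : ℝ) - t|) :
    lowerMinkowskiDim (range fun t : D => WithLp.toLp 2 ((t : ℝ), h t + g t)) =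
        lowerMinkowskiDim (range fun t : D => WithLp.toLp 2 ((t : ℝ), h t)) ∧
      upperMinkowskiDim (range fun t : D => WithLp.toLp 2 ((t : ℝ), h t + g t)) =
        upperMinkowskiDim (range fun t : D => WithLp.toLp 2 ((t : ℝ), h t)) := by
  have hL : 0 < 2 + K := by linarith
  have h1 := minkowskiDim_range_le (p := fun t : D => WithLp.toLp 2 ((t : ℝ), h t + g t))
    (q := fun t : D => WithLp.toLp 2 ((t : ℝ), h t)) hL
    fun s t => dist_graph_add_le (hg s t) hK
  have h2 := minkowskiDim_range_le (p := fun t : D => WithLp.toLp 2 ((t : ℝ), h t))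
    (q := fun t : D => WithLp.toLp 2 ((t : ℝ), h t + g t)) hL fun s t => by
      have := dist_graph_add_le (x := h s + g s) (y := h t + g t) (u := -g s) (v := -g t)
        (s := (s : ℝ)) (t := t) (K := K) (by
          rw [← neg_sub', norm_neg]; exact hg s t) hK
      simpa using this
  exact ⟨h1.1.antisymm h2.1, h1.2.antisymm h2.2⟩

/-- One-sided limits bound f near each point, and compactness of [0,1] makes the bound global. -/
lemma IsCadlag.isBounded_range {E : Type*} [PseudoMetricSpace E] {f : I → E} (hf : IsCadlag f) :
    Bornology.IsBounded (range f) := by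
  have hloc : ∀ t : I, ∃ s ∈ 𝓝 t, Bornology.IsBounded (f '' s) := by
    intro t
    have bdd : ∀ (l : Filter I) (x : E), Tendsto f l (𝓝 x) →
        ∃ s ∈ l, Bornology.IsBounded (f '' s) := fun l x h =>
      ⟨_, h (Metric.ball_mem_nhds x one_pos),
        Metric.isBounded_ball.subset (image_preimage_subset f _)⟩
    obtain ⟨l, hl⟩ := hf.2 t
    obtain ⟨s₁, hs₁, b₁⟩ := bdd _ _ hl
    obtain ⟨s₂, hs₂, b₂⟩ := bdd _ _ (hf.1 t)
    refine ⟨s₁ ∪ (s₂ ∪ {t}), ?_, ?_⟩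
    · rw [← nhdsLT_sup_nhdsGE, ← Ioi_insert, nhdsWithin_insert]
      refine ⟨mem_of_superset hs₁ (by grind), ?_⟩
      refine ⟨?_, mem_of_superset hs₂ (by grind)⟩
      simp
    · rw [image_union, image_union, image_singleton]
      exact b₁.union (b₂.union Bornology.isBounded_singleton)
  rw [← image_univ]
  refine isCompact_univ.induction_on (p := fun s => Bornology.IsBounded (f '' s)) (by simp)
    (fun s t hst ht => ht.subset (image_mono hst)) (fun s t hs ht => ?_) fun t _ => ?_
  · rw [image_union]; exact hs.union ht
  · rw [nhdsWithin_univ]; exact hloc t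

lemma isBounded_graphOver {h : I → EuclideanSpace ℝ (Fin d)}
    (hh : Bornology.IsBounded (range h)) (A : Set I) : Bornology.IsBounded (graphOver h A) := by
  have h1 : Bornology.IsBounded ((Icc (0 : ℝ) 1) ×ˢ range h) :=
    (Metric.isBounded_Icc 0 1).prod hh
  have h2 := (WithLp.prod_antilipschitzWith_ofLp 2 ℝ (EuclideanSpace ℝ (Fin d))).isBounded_preimage h1
  refine h2.subset ?_
  rintro _ ⟨t, -, rfl⟩
  exact ⟨t.2, mem_range_self t⟩

/-- Every set of times has a countable subset over which the graph of `g + f` is dense in the graph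
over the whole set, for all continuous `g`. -/
lemma exists_countable_graphOver_subset_closure (f : I → EuclideanSpace ℝ (Fin d)) {A : Set I}
    (hA : A.Nonempty) :
    ∃ D ⊆ A, D.Countable ∧ D.Nonempty ∧ ∀ g : I → EuclideanSpace ℝ (Fin d), Continuous g →
      graphOver (fun t => g t + f t) A ⊆ closure (graphOver (fun t => g t + f t) D) := by
  -- Density is taken in the graph of f, not just in A, so that jumps of f are followed. The
  -- continuous map (t, y) ↦ (t, g t + y) then transports it for every g at once.
  have hsep := TopologicalSpace.IsSeparable.of_separableSpace
    ((fun t : I => (t, f t)) '' A)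
  obtain ⟨c, hcA, hc, hcl⟩ := hsep.exists_countable_dense_subset
  obtain ⟨D, hDA, hbij⟩ := SurjOn.exists_bijOn_subset (f := fun t : I => (t, f t)) (s := A) (t := c)
    hcA
  have himg : (fun t : I => (t, f t)) '' D = c := hbij.image_eq
  have hDc : D.Countable := by
    refine (hc.image Prod.fst).mono ?_
    intro t ht
    exact ⟨(t, f t), himg ▸ mem_image_of_mem _ ht, rfl⟩
  refine ⟨D, hDA, hDc, ?_, fun g hg => ?_⟩
  · obtain ⟨a, ha⟩ := hA
    have h1 : (closure c).Nonempty := ⟨_, hcl (mem_image_of_mem _ ha)⟩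
    rw [closure_nonempty_iff, ← himg] at h1
    exact h1.of_image
  · rintro _ ⟨t, ht, rfl⟩
    let Ψ : I × EuclideanSpace ℝ (Fin d) → WithLp 2 (ℝ × EuclideanSpace ℝ (Fin d)) := fun p =>
      WithLp.toLp 2 ((p.1 : ℝ), g p.1 + p.2)
    have hΨ : Continuous Ψ := by fun_prop
    have h1 := hcl (mem_image_of_mem _ ht)
    have h2 := image_closure_subset_closure_image hΨ (mem_image_of_mem Ψ h1)
    rw [← himg, image_image] at h2
    exact h2

end Graph

/-! ### Almost sure constancy over a countable set of times -/

section Constancy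

variable {Ω : Type*} {mΩ : MeasurableSpace Ω} {P : Measure Ω} {d : ℕ}

/-- The graph over `D` of the sum of `f` and of the path with coordinates `x`. -/
def coordGraph (f : I → EuclideanSpace ℝ (Fin d)) (D : Set I) (x : Fin d × I → ℝ) :
    Set (WithLp 2 (ℝ × EuclideanSpace ℝ (Fin d))) :=
  range fun t : D => WithLp.toLp 2 ((t : ℝ), WithLp.toLp 2 (fun i => x (i, t)) + f t)

lemma measurable_minkowskiDim_coordGraph (f : I → EuclideanSpace ℝ (Fin d)) {D : Set I}
    (hD : D.Countable) (hne : D.Nonempty) :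
    (Measurable fun x => lowerMinkowskiDim (coordGraph f D x)) ∧
      Measurable fun x => upperMinkowskiDim (coordGraph f D x) := by
  have : Countable D := hD.to_subtype
  have : Nonempty D := hne.to_subtype
  borelize (WithLp 2 (ℝ × EuclideanSpace ℝ (Fin d)))
  have hp : ∀ t : D, Measurable fun x : Fin d × I → ℝ =>
      WithLp.toLp 2 ((t : ℝ), WithLp.toLp 2 (fun i => x (i, t)) + f t) := by
    intro t
    have h1 : Continuous fun y : Fin d → ℝ => WithLp.toLp 2 ((t : ℝ), WithLp.toLp 2 y + f t) := by
      fun_prop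
    exact h1.measurable.comp (measurable_pi_lambda _ fun i => measurable_pi_apply _)
  exact ⟨measurable_lowerMinkowskiDim_range hp, measurable_upperMinkowskiDim_range hp⟩

/-- For a fixed path x the subtracted sum is a Lipschitz function of time. Its constant depends on
x, which is harmless because the invariance is pathwise. -/
lemma minkowskiDim_coordGraph_sub_sum (f : I → EuclideanSpace ℝ (Fin d)) {D : Set I}
    (hne : D.Nonempty) (x : Fin d × I → ℝ) {T : Finset I} {K : ℝ≥0} {c : I → T → ℝ}
    (hc : LipschitzWith K c) :
    lowerMinkowskiDim (coordGraph f D x) =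
        lowerMinkowskiDim (coordGraph f D fun p => x p - ∑ k : T, c p.2 k * x (p.1, k)) ∧
      upperMinkowskiDim (coordGraph f D x) =
        upperMinkowskiDim (coordGraph f D fun p => x p - ∑ k : T, c p.2 k * x (p.1, k)) := by
  have : Nonempty D := hne.to_subtype
  let e : T → EuclideanSpace ℝ (Fin d) := fun k => WithLp.toLp 2 fun i => x (i, k)
  let g : D → EuclideanSpace ℝ (Fin d) := fun t => -∑ k : T, c t k • e k
  have hg : ∀ s t : D, ‖g s - g t‖ ≤ (∑ k : T, K * ‖e k‖) * |(s : ℝ) - t| := by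
    intro s t
    have h1 : g s - g t = ∑ k : T, (c t k - c s k) • e k := by
      simp only [g, sub_smul, Finset.sum_sub_distrib]
      abel
    rw [h1, Finset.sum_mul]
    refine norm_sum_le_of_le _ fun k _ => ?_
    rw [norm_smul, mul_right_comm]
    refine mul_le_mul_of_nonneg_right ?_ (norm_nonneg _)
    have h2 := (dist_le_pi_dist (c t) (c s) k).trans (hc.dist_le_mul t s)
    rwa [dist_comm (t : I), Subtype.dist_eq, Real.dist_eq, Real.dist_eq] at h2
  have key := minkowskiDim_graph_add_eq
    (fun t : D => WithLp.toLp 2 (fun i => x (i, t)) + f t) g (by positivity) hg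
  have h3 : (coordGraph f D fun p => x p - ∑ k : T, c p.2 k * x (p.1, k)) =
      range fun t : D => WithLp.toLp 2 ((t : ℝ),
        (WithLp.toLp 2 (fun i => x (i, t)) + f t) + g t) := by
    unfold coordGraph
    congr 1
    ext1 t
    congr 2
    ext i
    simp [g, e]
    ring
  rw [h3]
  exact ⟨key.1.symm, key.2.symm⟩

/-- The Minkowski dimensions of the graph, over a countable set of times, of a Gaussian process
with the covariance of a Brownian motion plus a drift are almost surely constant. -/
lemma exists_ae_minkowskiDim_coordGraph_eq {X : Fin d × I → Ω → ℝ} (hX : IsGaussianProcess X P)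
    (hXm : ∀ p, Measurable (X p))
    (hcov : ∀ p q, cov[X p, X q; P] = if p.1 = q.1 then min (p.2 : ℝ) q.2 else 0)
    (f : I → EuclideanSpace ℝ (Fin d)) {D : Set I} (hD : D.Countable) (hne : D.Nonempty) :
    ∃ a b : EReal, ∀ᵐ ω ∂P, lowerMinkowskiDim (coordGraph f D fun p => X p ω) = a ∧
      upperMinkowskiDim (coordGraph f D fun p => X p ω) = b := by
  have : IsProbabilityMeasure P := hX.isProbabilityMeasure
  have hm := measurable_minkowskiDim_coordGraph f hD hne
  obtain ⟨a, ha⟩ := exists_ae_eq_const_of_forall_finset hXm hm.1 (P := P) fun S => by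
    obtain ⟨T, K, c, hc, hind⟩ := exists_indepFun_sub_sum hX hcov S
    exact ⟨_, hind, fun ω => (minkowskiDim_coordGraph_sub_sum f hne (fun p => X p ω) hc).1⟩
  obtain ⟨b, hb⟩ := exists_ae_eq_const_of_forall_finset hXm hm.2 (P := P) fun S => by
    obtain ⟨T, K, c, hc, hind⟩ := exists_indepFun_sub_sum hX hcov S
    exact ⟨_, hind, fun ω => (minkowskiDim_coordGraph_sub_sum f hne (fun p => X p ω) hc).2⟩
  exact ⟨a, b, ha.and hb⟩

lemma covariance_congr_ae {X Y X' Y' : Ω → ℝ} (hX : X =ᵐ[P] X') (hY : Y =ᵐ[P] Y') :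
    cov[X, Y; P] = cov[X', Y'; P] := by
  rw [covariance, covariance, integral_congr_ae hX, integral_congr_ae hY]
  refine integral_congr_ae ?_
  filter_upwards [hX, hY] with ω h1 h2
  rw [h1, h2]

lemma IsStandardBrownian.ae_continuous {B : ℝ≥0 → Ω → EuclideanSpace ℝ (Fin d)}
    (hB : IsStandardBrownian B P) : ∀ᵐ ω ∂P, Continuous fun t => B t ω := by
  filter_upwards [ae_all_iff.2 fun i => (hB.coord i).cont] with ω h
  exact (PiLp.continuous_toLp 2 (fun _ : Fin d => ℝ)).comp (continuous_pi h)

end Constancy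

end BrownianDrift

open BrownianDrift MeasureTheory ProbabilityTheory in
theorem mainTheorem5 {Ω : Type*} [MeasurableSpace Ω]
    (P : MeasureTheory.Measure Ω) [MeasureTheory.IsProbabilityMeasure P]
    (d : ℕ) (hd : 1 ≤ d)
    (B : NNReal → Ω → EuclideanSpace ℝ (Fin d)) (hB : BrownianDrift.IsStandardBrownian B P)
    (f : unitInterval → EuclideanSpace ℝ (Fin d)) (hf : BrownianDrift.IsCadlag f)
    (A : Set unitInterval) (hA : A.Nonempty) :
    ∃ c₃ c₄ : ℝ, ∀ᵐ ω ∂P,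
      BrownianDrift.lowerMinkowskiDim
          (BrownianDrift.graphOver (BrownianDrift.driftedPath B f ω) A) = (c₃ : EReal) ∧
      BrownianDrift.upperMinkowskiDim
          (BrownianDrift.graphOver (BrownianDrift.driftedPath B f ω) A) = (c₄ : EReal) := by
  obtain ⟨D, hDA, hDc, hDne, hdense⟩ := exists_countable_graphOver_subset_closure f hA
  let ι : Fin d × unitInterval → Fin d × NNReal := fun p => (p.1, unitInterval.toNNReal p.2)
  have hG := hB.isGaussianProcess.comp_right ι
  -- The coordinates of B are only known to be a.e. measurable; measurable versions agree with them
  -- simultaneously on the countable set D.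
  let X : Fin d × unitInterval → Ω → ℝ := fun p => (hG.aemeasurable p).mk
  have hXB : ∀ p : Fin d × unitInterval, (fun ω => B (unitInterval.toNNReal p.2) ω p.1) =ᵐ[P] X p :=
    fun p => (hG.aemeasurable p).ae_eq_mk
  have hcov : ∀ p q, cov[X p, X q; P] = if p.1 = q.1 then min (p.2 : ℝ) q.2 else 0 := fun p q =>
    (covariance_congr_ae (hXB p) (hXB q)).symm.trans (hB.covariance (ι p) (ι q))
  obtain ⟨a, b, hab⟩ := exists_ae_minkowskiDim_coordGraph_eq (hG.congr hXB)
    (fun p => (hG.aemeasurable p).measurable_mk) hcov f hDc hDne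
  have hX : ∀ᵐ ω ∂P, ∀ t : D, ∀ i, B (unitInterval.toNNReal t) ω i = X (i, t) ω := by
    have : Countable D := hDc.to_subtype
    exact ae_all_iff.2 fun t => ae_all_iff.2 fun i => hXB (i, t)
  have hdim : ∀ᵐ ω ∂P, (lowerMinkowskiDim (graphOver (driftedPath B f ω) A) = a ∧
      upperMinkowskiDim (graphOver (driftedPath B f ω) A) = b) ∧ 0 ≤ a ∧ a ≤ b ∧ b < ⊤ := by
    filter_upwards [hab, hX, hB.ae_continuous] with ω h1 h2 h3
    have hc : Continuous fun t : unitInterval => B (unitInterval.toNNReal t) ω :=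
      h3.comp unitInterval.toNNReal_continuous
    have hgr : graphOver (driftedPath B f ω) D = coordGraph f D fun p => X p ω := by
      rw [graphOver, Set.image_eq_range, coordGraph]
      congr 1
      ext1 t
      have : B (unitInterval.toNNReal t) ω = WithLp.toLp 2 fun i => X (i, t) ω := by
        ext i
        exact h2 t i
      rw [driftedPath, this]
    have hne : (graphOver (driftedPath B f ω) D).Nonempty := hDne.image _
    have h4 := minkowskiDim_eq_of_dense hne (Set.image_mono hDA) (hdense _ hc)
    rw [hgr, h1.1, h1.2] at h4
    have hbdd : Bornology.IsBounded (Set.range (driftedPath B f ω)) := by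
      refine ((isCompact_range hc).isBounded.add hf.isBounded_range).subset ?_
      rintro _ ⟨t, rfl⟩
      exact Set.add_mem_add (Set.mem_range_self t) (Set.mem_range_self t)
    refine ⟨h4, ?_, ?_, ?_⟩
    · rw [← h4.1]
      exact lowerMinkowskiDim_nonneg (hA.image _)
    · rw [← h4.1, ← h4.2]
      exact lowerMinkowskiDim_le_upperMinkowskiDim _
    · rw [← h4.2]
      exact upperMinkowskiDim_lt_top (isBounded_graphOver hbdd A)
  -- The bounds on the deterministic a and b need only one sample point, which exists as P is a
  -- probability measure.
  obtain ⟨-, -, h0, hle, htop⟩ := hdim.exists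
  lift b to ℝ using ⟨htop.ne, ((EReal.bot_lt_zero.trans_le h0).trans_le hle).ne'⟩
  lift a to ℝ using ⟨(hle.trans_lt htop).ne, (EReal.bot_lt_zero.trans_le h0).ne'⟩
  exact ⟨a, b, hdim.mono fun ω h => h.1⟩
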